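/- **Setting.** Let $M,d\ge 1$ and let $(X_m,y_m)_{m=1}^M$, with $X_m\in\mathbb R^{n_m\times d}$ and $y_m\in\mathbb R^{n_m}$, be linear regression tasks that are jointly realizable: there is $w_\star\in\mathbb R^d$ with $X_mw_\star=y_m$ for all $m$. Let $R=\max_m\|X_m\|$ (spectral norm), $\mathcal L(w;m)=\tfrac12\|X_mw-y_m\|^2$ and $\mathcal L(w)=\frac1M\sum_{m=1}^M\mathcal L(w;m)$. Let $k\ge 1$, let $\tau_1,\dots,\tau_k$ be a random ordering of tasks from $\{1,\dots,M\}$, and let $w_0\in\mathbb R^d$ be any starting point (in particular $w_0=0$). *Scheme 1* with coefficient $\lambda>0$: for $t=1,\dots,k$, $w_t=\arg\min_{w}\big\{\tfrac12\|X_{\tau_t}w-y_{\tau_t}\|^2+\tfrac{\lambda}{2}\|w-w_{t-1}\|^2\big\}$. *Scheme 2* with step size $\gamma$ and budget $N$: for $t=1,\dots,k$, $w_t$ is obtained from $w_{t-1}$ by $N$ gradient steps of size $\gamma$ on $\mathcal L(\cdot;\tau_t)$. **Rates for fixed regularization strength.** Let $w_\star$ be any vector with $X_mw_\star=y_m$ for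 all $m$. Suppose that the ordering is with replacement, i.e. $\tau_1,\dots,\tau_k$ are independent and uniform on $\{1,\dots,M\}$. (i) For Scheme 1 with any $\lambda>0$, $$\mathbb E_\tau\mathcal L(w_k)\le\frac{e\,\|w_0-w_\star\|^2R^2}{2\cdot\frac{R^2}{R^2+\lambda}\cdot\big(2-\frac{R^2}{R^2+\lambda}\big)\cdot k^{\,1-\frac{R^2}{R^2+\lambda}\left(1-\frac{R^2}{4(R^2+\lambda)}\right)}}.$$ (ii) For Scheme 2 with any $\gamma\in(0,1/R^2)$ (where $R>0$) and any integer $N\ge1$, $$\mathbb E_\tau\mathcal L(w_k)\le\frac{e\,\|w_0-w_\star\|^2R^2}{2\cdot\big(1-(1-\gamma R^2)^{2N}\big)\cdot k^{\,1-\left(1-(1-\gamma R^2)^N\right)\left(1-\frac{1-(1-\gamma R^2)^N}{4}\right)}}.$$ (If $R=0$, then $\mathcal L\equiv0$ and the right-hand side of (i) is read as $0$.) **Extension to orderings without replacement.** There is an absolute constant $C$ such that, for all data as above with $k\le M$, if $(\tau_1,\dots,\tau_k)$ is instead uniform among all $k$-tuples of distinct elements of $\{1,\dots,M\}$, then (i)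 and (ii) hold with their right-hand sides multiplied by $C$. -/

import Mathlib

open MeasureTheory ProbabilityTheory

noncomputable section

namespace ContinualRegression

/-- A collection of `M` linear regression tasks `(X m, y m)` in dimension `d`; the `m`-th task has
`n m` samples. -/
structure TaskCollection (d M : ℕ) where
  n : Fin M → ℕ
  X : (m : Fin M) → Matrix (Fin (n m)) (Fin d) ℝ
  y : (m : Fin M) → EuclideanSpace ℝ (Fin (n m))

namespace TaskCollection

variable {d M : ℕ} (T : TaskCollection d M)

/-- The data matrix of task `m` as a continuous linear map between Euclidean spaces. -/
def op (m : Fin M) : EuclideanSpace ℝ (Fin d) →L[ℝ] EuclideanSpace ℝ (Fin (T.n m)) :=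
  LinearMap.toContinuousLinearMap (Matrix.toEuclideanLin (T.X m))

/-- The data radius `R = max_m ‖X m‖`, with the spectral norm. -/
def radius : ℝ := ⨆ m : Fin M, ‖T.op m‖

/-- The loss of task `m`. -/
def taskLoss (m : Fin M) (w : EuclideanSpace ℝ (Fin d)) : ℝ :=
  (1 / 2) * ‖T.op m w - T.y m‖ ^ 2

/-- The average (population) loss over all tasks. -/
def averageLoss (w : EuclideanSpace ℝ (Fin d)) : ℝ :=
  (1 / (M : ℝ)) * ∑ m : Fin M, T.taskLoss m w

/-- `w` is an offline solution: it solves every task exactly. -/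
def IsOfflineSolution (w : EuclideanSpace ℝ (Fin d)) : Prop :=
  ∀ m : Fin M, T.op m w = T.y m

/-- The regularized objective minimized on task `m` when starting from `w`. -/
def regularizedObjective (lam : ℝ) (m : Fin M) (w v : EuclideanSpace ℝ (Fin d)) : ℝ :=
  (1 / 2) * ‖T.op m v - T.y m‖ ^ 2 + (lam / 2) * ‖v - w‖ ^ 2

/-- For a positive coefficient, the regularized objective has exactly one minimizer. -/
theorem existsUnique_isMinOn_regularizedObjective {lam : ℝ} (hlam : 0 < lam) (m : Fin M)
    (w : EuclideanSpace ℝ (Fin d)) :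
    ∃! v, IsMinOn (T.regularizedObjective lam m w) Set.univ v := by
  have hcont : Continuous (T.regularizedObjective lam m w) := by
    unfold regularizedObjective
    fun_prop
  have hco : Filter.Tendsto (T.regularizedObjective lam m w)
      (Filter.cocompact (EuclideanSpace ℝ (Fin d))) Filter.atTop := by
    have h1 : Filter.Tendsto (fun v : EuclideanSpace ℝ (Fin d) => ‖v‖ - ‖w‖)
        (Filter.cocompact _) Filter.atTop :=
      Filter.tendsto_atTop_add_const_right _ _ tendsto_norm_cocompact_atTop
    have h2 : Filter.Tendsto (fun v : EuclideanSpace ℝ (Fin d) => ‖v - w‖)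
        (Filter.cocompact _) Filter.atTop :=
      Filter.tendsto_atTop_mono (fun v => norm_sub_norm_le v w) h1
    have h3 : Filter.Tendsto (fun v : EuclideanSpace ℝ (Fin d) => (lam / 2) * ‖v - w‖ ^ 2)
        (Filter.cocompact _) Filter.atTop :=
      Filter.Tendsto.const_mul_atTop (by positivity)
        ((Filter.tendsto_pow_atTop two_ne_zero).comp h2)
    refine Filter.tendsto_atTop_mono (fun v => ?_) h3
    have : 0 ≤ (1 / 2) * ‖T.op m v - T.y m‖ ^ 2 := by positivity
    unfold regularizedObjective
    linarith
  obtain ⟨a, ha⟩ := hcont.exists_forall_le hco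
  refine ⟨a, fun v _ => ha v, fun b hb => ?_⟩
  have hab : T.regularizedObjective lam m w a
      = T.regularizedObjective lam m w b := le_antisymm (ha b) (hb (Set.mem_univ a))
  have hmid := ha ((1 / 2 : ℝ) • (a + b))
  have e1 : T.op m ((1 / 2 : ℝ) • (a + b)) - T.y m
      = (1 / 2 : ℝ) • ((T.op m a - T.y m) + (T.op m b - T.y m)) := by
    rw [map_smul, map_add]
    module
  have e2 : (1 / 2 : ℝ) • (a + b) - w = (1 / 2 : ℝ) • ((a - w) + (b - w)) := by module
  have p1 := parallelogram_law_with_norm ℝ (T.op m a - T.y m) (T.op m b - T.y m)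
  have p2 := parallelogram_law_with_norm ℝ (a - w) (b - w)
  have e3 : a - w - (b - w) = a - b := by abel
  rw [e3] at p2
  unfold regularizedObjective at hab hmid
  rw [e1, e2, norm_smul, norm_smul, mul_pow, mul_pow] at hmid
  norm_num at hmid
  have h0 : ‖a - b‖ = 0 := by
    have hn := mul_self_nonneg ‖T.op m a - T.y m - (T.op m b - T.y m)‖
    have : lam * (‖a - b‖ * ‖a - b‖) ≤ 0 := by
      have p2' := congrArg (fun x => lam * x) p2
      nlinarith
    have h5 : ‖a - b‖ * ‖a - b‖ ≤ 0 := by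
      by_contra hcon
      push Not at hcon
      have := mul_pos hlam hcon
      linarith
    nlinarith [norm_nonneg (a - b)]
  exact (sub_eq_zero.mp (norm_eq_zero.mp h0)).symm

/-- One iteration of regularized continual regression on task `m`: the minimizer of the regularized
objective, which exists and is unique whenever `0 < lam`. -/
def regularizedStep (lam : ℝ) (m : Fin M) (w : EuclideanSpace ℝ (Fin d)) :
    EuclideanSpace ℝ (Fin d) :=
  Classical.epsilon fun v => IsMinOn (T.regularizedObjective lam m w) Set.univ v

theorem isMinOn_regularizedStep {lam : ℝ} (hlam : 0 < lam) (m : Fin M)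
    (w : EuclideanSpace ℝ (Fin d)) :
    IsMinOn (T.regularizedObjective lam m w) Set.univ (T.regularizedStep lam m w) :=
  Classical.epsilon_spec (T.existsUnique_isMinOn_regularizedObjective hlam m w).exists

/-- One iteration of budgeted continual regression on task `m`: `N` gradient steps of size `γ` on
the unregularized loss of the task. -/
def budgetedStep (γ : ℝ) (N : ℕ) (m : Fin M) (w : EuclideanSpace ℝ (Fin d)) :
    EuclideanSpace ℝ (Fin d) :=
  (fun v => v - γ • gradient (T.taskLoss m) v)^[N] w

end TaskCollection

/-- The last iterate `w_k` of a continual scheme started at `w₀` whose iteration on task `m` is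
`step m`, run along the task ordering `τ`. -/
def lastIterate {d M : ℕ}
    (step : Fin M → EuclideanSpace ℝ (Fin d) → EuclideanSpace ℝ (Fin d))
    (w₀ : EuclideanSpace ℝ (Fin d)) :
    (k : ℕ) → (Fin k → Fin M) → EuclideanSpace ℝ (Fin d)
  | 0, _ => w₀
  | k + 1, τ => step (τ (Fin.last k)) (lastIterate step w₀ k (fun i => τ i.castSucc))

/-- The law of a random ordering with replacement: `τ_1, …, τ_k` are independent and uniform. -/
def withReplacement (M k : ℕ) : Measure (Fin k → Fin M) :=
  Measure.pi fun _ => uniformOn (Set.univ : Set (Fin M))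

/-- The law of a random ordering without replacement: `τ` is uniform among the orderings with
`k` distinct tasks. -/
def withoutReplacement (M k : ℕ) : Measure (Fin k → Fin M) :=
  uniformOn {τ : Fin k → Fin M | Function.Injective τ}

end ContinualRegression

end

/-! Since all tasks share the solution `wStar`, one iteration of either scheme on task m acts on the
error as 1 - A m, where A m = g(Xᵀ X) with g(s) = s / (s + λ) or g(s) = 1 - (1 - γ s)^N. So each
scheme is SGD with step size 1 on surrogate quadratic losses with spectrum in [0, β], β = g(R²), and
the task losses are bounded by the surrogate losses up to a factor κ.

Let F t be the expected surrogate loss of the t-th iterate u t on the task about to be visited.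
Expanding ‖u‖² bounds the sum of all F t (`sum_expectedLoss_le`). Expanding ‖u - u s‖² bounds the
sum of F after time s by a multiple of F s (`sum_expectedLoss_after_le`), because by exchangeability
every later task sees u s with the same expected loss. A discrete Grönwall argument
(`prod_mul_le_sum_of_tail_le`) then gives F n = O(n^(-q)) with q = (1 - β/2)², which is the stated
exponent.

With replacement, one extra draw makes F the average surrogate loss. Without replacement, the extra
draw only covers unseen tasks. For a task visited at step i, step i is deleted: the shortened run
does not depend on that task, so the task is fresh for it, and the error caused by the deletion is
controlled by F at step i, whose sum is bounded. -/

namespace ContinualRegression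

/-! ### Last-iterate bound for SGD with unit steps on random quadratics -/

section Core

variable {V : Type*} [NormedAddCommGroup V] [InnerProductSpace ℝ V]

/-- The linear operator `A` is symmetric with spectrum in `[0, β]`. -/
structure IsSymmBetween (β : ℝ) (A : V →ₗ[ℝ] V) : Prop where
  symm : A.IsSymmetric
  nonneg : ∀ v, 0 ≤ inner ℝ (A v) v
  sq_le : ∀ v, ‖A v‖ ^ 2 ≤ β * inner ℝ (A v) v

namespace IsSymmBetween

variable {β : ℝ} {A : V →ₗ[ℝ] V}

theorem inner_le (hA : IsSymmBetween β A) (hβ : 0 ≤ β) (v : V) :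
    inner ℝ (A v) v ≤ β * ‖v‖ ^ 2 := by
  have h1 := hA.sq_le v
  have h2 := real_inner_le_norm (A v) v
  have h3 : ‖A v‖ ≤ β * ‖v‖ := by
    by_contra! h
    have h4 : 0 < ‖A v‖ := lt_of_le_of_lt (by positivity) h
    nlinarith [mul_le_mul_of_nonneg_left h2 hβ]
  nlinarith [norm_nonneg v]

/-- The cross term 2⟪A v, z⟫ is split by Young's inequality in the semi-inner product of A, that is,
by positivity of A at c • v - z. The comparator z thus enters only through its own loss. -/
theorem norm_sub_sq_le (hA : IsSymmBetween β A) (v z : V) {c : ℝ} (hc : 0 < c) :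
    ‖v - A v - z‖ ^ 2 ≤ ‖v - z‖ ^ 2 - (2 - β - c) * inner ℝ (A v) v
      + 1 / c * inner ℝ (A z) z := by
  have e : v - A v - z = (v - z) - A v := by abel
  rw [e, norm_sub_sq_real, inner_sub_left, real_inner_comm (A v) v, real_inner_comm (A v) z]
  have h1 := hA.sq_le v
  have h2 := hA.nonneg (c • v - z)
  have h3 : inner ℝ (A z) v = inner ℝ (A v) z := by
    rw [hA.symm z v, real_inner_comm]
  simp only [map_sub, map_smul, inner_sub_left, inner_sub_right, inner_smul_left,
    inner_smul_right, RCLike.conj_to_real, h3] at h2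
  have h4 : 1 / c * (c * (c * inner ℝ (A v) v - inner ℝ (A v) z)
      - (c * inner ℝ (A v) z - inner ℝ (A z) z)) =
      c * inner ℝ (A v) v - 2 * inner ℝ (A v) z + 1 / c * inner ℝ (A z) z := by
    field_simp
    ring
  have h5 : 0 ≤ c * inner ℝ (A v) v - 2 * inner ℝ (A v) z + 1 / c * inner ℝ (A z) z := by
    rw [← h4]
    refine mul_nonneg (by positivity) (by linarith)
  linarith

theorem norm_sub_apply_sq_le (hA : IsSymmBetween β A) (v : V) :
    ‖v - A v‖ ^ 2 ≤ ‖v‖ ^ 2 - (2 - β) * inner ℝ (A v) v := by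
  rw [norm_sub_sq_real, real_inner_comm]
  linarith [hA.sq_le v]

theorem norm_sub_apply_le (hA : IsSymmBetween β A) (hβ : β ≤ 2) (v : V) :
    ‖v - A v‖ ≤ ‖v‖ := by
  have h := hA.norm_sub_apply_sq_le v
  have h' := mul_nonneg (sub_nonneg.2 hβ) (hA.nonneg v)
  exact le_of_sq_le_sq (by linarith) (norm_nonneg v)

theorem inner_add_le (hA : IsSymmBetween β A) (u v : V) :
    inner ℝ (A (u + v)) (u + v) ≤ 2 * inner ℝ (A u) u + 2 * inner ℝ (A v) v := by
  have h := hA.nonneg (u - v)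
  simp only [map_sub, map_add, inner_sub_left, inner_sub_right, inner_add_left,
    inner_add_right] at h ⊢
  linarith

end IsSymmBetween

variable {Ω : Type*} {S : Finset Ω} {β : ℝ} {B : ℕ → Ω → V →ₗ[ℝ] V} {u : ℕ → Ω → V}

/-- Each step lowers ‖u‖² by at least (2 - β) times the current loss, and the total decrease is at
most ‖u 0‖². Expectations are unnormalised sums over `S`. -/
theorem sum_expectedLoss_le (hB : ∀ t ω, IsSymmBetween β (B t ω))
    (hu : ∀ t ω, u (t + 1) ω = u t ω - B t ω (u t ω)) (n : ℕ) :
    (2 - β) * ∑ t ∈ Finset.range n, ∑ ω ∈ S, inner ℝ (B t ω (u t ω)) (u t ω)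
      ≤ ∑ ω ∈ S, ‖u 0 ω‖ ^ 2 := by
  suffices h : (2 - β) * ∑ t ∈ Finset.range n, ∑ ω ∈ S, inner ℝ (B t ω (u t ω)) (u t ω)
      + ∑ ω ∈ S, ‖u n ω‖ ^ 2 ≤ ∑ ω ∈ S, ‖u 0 ω‖ ^ 2 by
    have : 0 ≤ ∑ ω ∈ S, ‖u n ω‖ ^ 2 := Finset.sum_nonneg fun _ _ => by positivity
    linarith
  induction n with
  | zero => simp
  | succ n ih =>
    rw [Finset.sum_range_succ, mul_add]
    have h : ∑ ω ∈ S, ‖u (n + 1) ω‖ ^ 2 ≤ ∑ ω ∈ S, ‖u n ω‖ ^ 2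
        - (2 - β) * ∑ ω ∈ S, inner ℝ (B n ω (u n ω)) (u n ω) := by
      rw [Finset.mul_sum, ← Finset.sum_sub_distrib]
      refine Finset.sum_le_sum fun ω _ => ?_
      rw [hu]
      exact (hB n ω).norm_sub_apply_sq_le _
    linarith

/-- The squared distance to the frozen iterate u s is tracked. The first step contributes ‖B s (u
s)‖², hence the β; each of the j later ones contributes the loss of u s on its own task divided by
c, which `hex` turns into the same quantity at time s. -/
theorem sum_expectedLoss_after_le (hB : ∀ t ω, IsSymmBetween β (B t ω))
    (hu : ∀ t ω, u (t + 1) ω = u t ω - B t ω (u t ω)) {c : ℝ} (hc : 0 < c) (s j : ℕ)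
    (hex : ∀ t, s ≤ t → t ≤ s + j → ∑ ω ∈ S, inner ℝ (B t ω (u s ω)) (u s ω)
      = ∑ ω ∈ S, inner ℝ (B s ω (u s ω)) (u s ω)) :
    (2 - β - c) * ∑ i ∈ Finset.range j,
        ∑ ω ∈ S, inner ℝ (B (s + 1 + i) ω (u (s + 1 + i) ω)) (u (s + 1 + i) ω)
      ≤ (β + j / c) * ∑ ω ∈ S, inner ℝ (B s ω (u s ω)) (u s ω) := by
  set F := ∑ ω ∈ S, inner ℝ (B s ω (u s ω)) (u s ω) with hF
  suffices h : (2 - β - c) * ∑ i ∈ Finset.range j,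
        ∑ ω ∈ S, inner ℝ (B (s + 1 + i) ω (u (s + 1 + i) ω)) (u (s + 1 + i) ω)
      + ∑ ω ∈ S, ‖u (s + 1 + j) ω - u s ω‖ ^ 2 ≤ (β + j / c) * F by
    have : 0 ≤ ∑ ω ∈ S, ‖u (s + 1 + j) ω - u s ω‖ ^ 2 :=
      Finset.sum_nonneg fun _ _ => by positivity
    linarith
  induction j with
  | zero =>
    simp only [Finset.range_zero, Finset.sum_empty, mul_zero, zero_add, add_zero,
      CharP.cast_eq_zero, zero_div, hF, Finset.mul_sum]
    refine Finset.sum_le_sum fun ω _ => ?_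
    have e : u (s + 1) ω - u s ω = -(B s ω (u s ω)) := by rw [hu]; abel
    rw [e, norm_neg]
    exact (hB s ω).sq_le _
  | succ j ih =>
    have ih' := ih fun t h1 h2 => hex t h1 (by omega)
    have h : ∑ ω ∈ S, ‖u (s + 1 + (j + 1)) ω - u s ω‖ ^ 2
        ≤ ∑ ω ∈ S, ‖u (s + 1 + j) ω - u s ω‖ ^ 2
        - (2 - β - c) *
          ∑ ω ∈ S, inner ℝ (B (s + 1 + j) ω (u (s + 1 + j) ω)) (u (s + 1 + j) ω)
        + 1 / c * F := by
      rw [← hex (s + 1 + j) (by omega) (by omega), Finset.mul_sum, Finset.mul_sum,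
        ← Finset.sum_sub_distrib, ← Finset.sum_add_distrib]
      refine Finset.sum_le_sum fun ω _ => ?_
      rw [← add_assoc, hu]
      exact (hB _ ω).norm_sub_sq_le _ _ hc
    rw [Finset.sum_range_succ, mul_add]
    push_cast
    have e : (β + ((j : ℝ) + 1) / c) * F = (β + j / c) * F + 1 / c * F := by ring
    linarith

/-- If the tail sums of `F` are controlled by the preceding terms, then `∑ t ≤ n, F t` dominates
`F n` by the stated factor. -/
theorem prod_mul_le_sum_of_tail_le {F : ℕ → ℝ} {n : ℕ} {q b : ℝ} (hb : 0 ≤ b) (hq : 0 ≤ q)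
    (h : ∀ s j, s + j = n → q * ∑ i ∈ Finset.range j, F (s + 1 + i) ≤ (b + j) * F s) :
    (∏ i ∈ Finset.range n, (1 + q / (i + 1 + b))) * F n ≤ ∑ t ∈ Finset.range (n + 1), F t := by
  -- The induction runs backwards from n, on the length of the tail: prepending F s multiplies a
  -- tail of length j + 1 by at least 1 + q / (j + 1 + b).
  suffices H : ∀ j s, s + j = n → (∏ i ∈ Finset.range j, (1 + q / (i + 1 + b))) * F n
      ≤ ∑ i ∈ Finset.range (j + 1), F (s + i) by
    simpa using H n 0 (by simp)
  intro j
  induction j with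
  | zero => rintro s rfl; simp
  | succ j ih =>
    intro s hs
    have ih' := ih (s + 1) (by omega)
    have h' := h s (j + 1) hs
    set T := ∑ i ∈ Finset.range (j + 1), F (s + 1 + i) with hT
    have e : ∑ i ∈ Finset.range (j + 1 + 1), F (s + i) = F s + T := by
      rw [Finset.sum_range_succ', hT, add_comm]
      congr 1
      exact Finset.sum_congr rfl fun i _ => by congr 1; omega
    rw [e, Finset.prod_range_succ]
    have hpos : 0 < (j : ℝ) + 1 + b := by positivity
    have h1 : q / (j + 1 + b) * T ≤ F s := by
      rw [div_mul_eq_mul_div, div_le_iff₀ hpos]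
      push_cast at h'
      linarith
    have h2 : (0 : ℝ) ≤ 1 + q / (j + 1 + b) := by positivity
    nlinarith [mul_le_mul_of_nonneg_right ih' h2]

/-- The left side telescopes into powers (1 + x)^q with x = 1 / (i + 1 + b), and Bernoulli gives (1
+ x)^q ≤ 1 + q x for q ≤ 1. -/
theorem rpow_div_le_prod {q b : ℝ} (hq0 : 0 ≤ q) (hq1 : q ≤ 1) (hb : 0 ≤ b) (n : ℕ) :
    ((n + 1 + b) / (1 + b)) ^ q ≤ ∏ i ∈ Finset.range n, (1 + q / (i + 1 + b)) := by
  induction n with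
  | zero => rw [Nat.cast_zero, zero_add, div_self (by positivity)]; simp
  | succ n ih =>
    rw [Finset.prod_range_succ]
    have hpos : 0 < (n : ℝ) + 1 + b := by positivity
    have e : (((n + 1 : ℕ) : ℝ) + 1 + b) / (1 + b)
        = ((n + 1 + b) / (1 + b)) * (1 + 1 / (n + 1 + b)) := by
      push_cast
      field_simp
      ring
    rw [e, Real.mul_rpow (by positivity) (by positivity)]
    refine mul_le_mul ih ?_ (by positivity) ((by positivity : (0 : ℝ) ≤ _).trans ih)
    have := rpow_one_add_le_one_add_mul_self (s := 1 / (n + 1 + b))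
      (by linarith [show 0 ≤ 1 / ((n : ℝ) + 1 + b) by positivity]) hq0 hq1
    linarith [show q * (1 / ((n : ℝ) + 1 + b)) = q / (n + 1 + b) by ring]

/-- Last-iterate bound for products of random operators `1 - B t` applied to a fixed vector, under
the consequence `hex` of exchangeability. -/
theorem expectedLoss_le (hβ0 : 0 ≤ β) (hβ1 : β ≤ 1) (hB : ∀ t ω, IsSymmBetween β (B t ω))
    (hu : ∀ t ω, u (t + 1) ω = u t ω - B t ω (u t ω)) (n : ℕ)
    (hex : ∀ s t, s ≤ t → t ≤ n → ∑ ω ∈ S, inner ℝ (B t ω (u s ω)) (u s ω)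
      = ∑ ω ∈ S, inner ℝ (B s ω (u s ω)) (u s ω)) {k : ℕ} (hk1 : 1 ≤ k) (hk : k ≤ n + 1) :
    ∑ ω ∈ S, inner ℝ (B n ω (u n ω)) (u n ω)
      ≤ 3 / 2 * (∑ ω ∈ S, ‖u 0 ω‖ ^ 2) / ((2 - β) * (k : ℝ) ^ ((1 - β / 2) ^ 2)) := by
  set F : ℕ → ℝ := fun t => ∑ ω ∈ S, inner ℝ (B t ω (u t ω)) (u t ω) with hF
  set q := (1 - β / 2) ^ 2 with hq
  -- This choice maximises c (2 - β - c), whose value is then q.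
  set c := 1 - β / 2 with hc
  have hc0 : 0 < c := by linarith
  have hq0 : 0 ≤ q := by positivity
  have hq1 : q ≤ 1 := by rw [hq]; nlinarith
  have hb0 : 0 ≤ β * c := by positivity
  -- The source of the constant 3/2, an upper bound for 1 + β c.
  have hb1 : β * c ≤ 1 / 2 := by rw [hc]; nlinarith [sq_nonneg (1 - β)]
  have hFn : 0 ≤ F n := Finset.sum_nonneg fun ω _ => (hB n ω).nonneg _
  have h1 : (∏ i ∈ Finset.range n, (1 + q / (i + 1 + β * c))) * F n
      ≤ ∑ t ∈ Finset.range (n + 1), F t := by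
    refine prod_mul_le_sum_of_tail_le hb0 hq0 fun s j hsj => ?_
    have h := sum_expectedLoss_after_le hB hu hc0 s j fun t h1 h2 => hex s t h1 (by omega)
    have h' := mul_le_mul_of_nonneg_left h hc0.le
    have e1 : c * ((β + j / c) * F s) = (β * c + j) * F s := by field_simp
    have e2 : q = c * (2 - β - c) := by rw [hq, hc]; ring
    rw [e1, ← mul_assoc, ← e2] at h'
    exact h'
  have h2 := sum_expectedLoss_le (S := S) hB hu (n + 1)
  have h3 := rpow_div_le_prod hq0 hq1 hb0 n
  have hk0 : (0 : ℝ) < k := by exact_mod_cast hk1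
  have hkq : 0 < (k : ℝ) ^ q := Real.rpow_pos_of_pos hk0 q
  have h4 : (k : ℝ) ^ q / (3 / 2) ≤ ((n + 1 + β * c) / (1 + β * c)) ^ q := by
    have hkn : (k : ℝ) ≤ n + 1 := by exact_mod_cast hk
    have h5 : (k : ℝ) / (3 / 2) ≤ (n + 1 + β * c) / (1 + β * c) := by
      gcongr <;> linarith
    calc (k : ℝ) ^ q / (3 / 2) ≤ (k : ℝ) ^ q / (3 / 2) ^ q := by
          gcongr
          calc ((3 : ℝ) / 2) ^ q ≤ (3 / 2) ^ (1 : ℝ) :=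
                Real.rpow_le_rpow_of_exponent_le (by norm_num) hq1
            _ = 3 / 2 := Real.rpow_one _
      _ = ((k : ℝ) / (3 / 2)) ^ q := (Real.div_rpow hk0.le (by norm_num) q).symm
      _ ≤ _ := Real.rpow_le_rpow (by positivity) h5 hq0
  have h6 : (k : ℝ) ^ q / (3 / 2) * F n ≤ ∑ t ∈ Finset.range (n + 1), F t :=
    (mul_le_mul_of_nonneg_right (h4.trans h3) hFn).trans h1
  have h7 : 0 < 2 - β := by linarith
  have h8 := mul_le_mul_of_nonneg_left h6 h7.le
  rw [le_div_iff₀ (by positivity)]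
  change F n * _ ≤ _
  linarith

end Core

/-! ### Exchangeable orderings -/

section Exchangeable

variable {ι κ : Type*} {S : Finset (ι → κ)}

/-- A finite set of tuples is closed under permuting the entries. -/
def PermInvariant (S : Finset (ι → κ)) : Prop :=
  ∀ τ ∈ S, ∀ σ : Equiv.Perm ι, τ ∘ σ ∈ S

theorem PermInvariant.sum_comp (hS : PermInvariant S) (σ : Equiv.Perm ι) (f : (ι → κ) → ℝ) :
    ∑ τ ∈ S, f (τ ∘ σ) = ∑ τ ∈ S, f τ := by
  refine Finset.sum_nbij' (fun τ => τ ∘ σ) (fun τ => τ ∘ σ.symm) (fun τ h => hS τ h σ)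
    (fun τ h => hS τ h _) (fun τ _ => ?_) (fun τ _ => ?_) fun _ _ => rfl
  · ext i; simp
  · ext i; simp

end Exchangeable

/-! ### Fresh and visited losses along an ordering -/

section Iterates

variable {d M : ℕ} {β : ℝ}
  {A : Fin M → EuclideanSpace ℝ (Fin d) →ₗ[ℝ] EuclideanSpace ℝ (Fin d)}
  {step : Fin M → EuclideanSpace ℝ (Fin d) → EuclideanSpace ℝ (Fin d)}
  {w₀ wStar : EuclideanSpace ℝ (Fin d)}

theorem lastIterate_succ (k : ℕ) (τ : Fin (k + 1) → Fin M) :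
    lastIterate step w₀ (k + 1) τ
      = step (τ (Fin.last k)) (lastIterate step w₀ k fun i => τ i.castSucc) := rfl

/-- The surrogate loss `⟪A m (w - wStar), w - wStar⟫` of task `m`, without the factor `1 / 2`. -/
noncomputable def surrogateLoss
    (A : Fin M → EuclideanSpace ℝ (Fin d) →ₗ[ℝ] EuclideanSpace ℝ (Fin d))
    (wStar : EuclideanSpace ℝ (Fin d)) (m : Fin M) (w : EuclideanSpace ℝ (Fin d)) : ℝ :=
  inner ℝ (A m (w - wStar)) (w - wStar)

theorem ofNat_castSucc {n : ℕ} (i : Fin n) : Fin.ofNat (n + 1) (i : ℕ) = i.castSucc := by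
  ext; simp

/-- The last entry of the tuple is not used by the iterate: it only serves as the test task. -/
theorem sum_freshLoss_le (hβ0 : 0 ≤ β) (hβ1 : β ≤ 1) (hA : ∀ m, IsSymmBetween β (A m))
    (hstep : ∀ m w, step m w - wStar = w - wStar - A m (w - wStar)) {n : ℕ}
    {S : Finset (Fin (n + 1) → Fin M)} (hS : PermInvariant S) {k : ℕ} (hk1 : 1 ≤ k)
    (hk : k ≤ n + 1) :
    ∑ τ ∈ S, surrogateLoss A wStar (τ (Fin.last n))
        (lastIterate step w₀ n fun i => τ i.castSucc)
      ≤ 3 / 2 * (S.card * ‖w₀ - wStar‖ ^ 2) / ((2 - β) * (k : ℝ) ^ ((1 - β / 2) ^ 2)) := by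
  have h := expectedLoss_le (S := S) hβ0 hβ1
    -- `Fin.ofNat` continues the ordering periodically to all times; exchangeability is only needed
    -- up to time n, where nothing wraps around.
    (B := fun t τ => A (τ (Fin.ofNat (n + 1) t)))
    (u := fun t τ => lastIterate step w₀ t (fun i => τ (Fin.ofNat (n + 1) i)) - wStar)
    (fun t τ => hA _) (fun t τ => by
      rw [lastIterate_succ, hstep]
      rfl) n ?_ hk1 hk
  · simp only [ofNat_castSucc, lastIterate, Finset.sum_const, nsmul_eq_mul] at h
    convert h using 2 with τ _
    simp [surrogateLoss, Fin.ofNat, Fin.last]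
  · intro s t hst ht
    -- The swap fixes all positions before s, so it leaves u s alone and replaces task t by task s.
    rw [← hS.sum_comp (Equiv.swap (Fin.ofNat (n + 1) s) (Fin.ofNat (n + 1) t))]
    refine Finset.sum_congr rfl fun τ _ => ?_
    have e : ∀ i : Fin s, Equiv.swap (Fin.ofNat (n + 1) s) (Fin.ofNat (n + 1) t)
        (Fin.ofNat (n + 1) i) = Fin.ofNat (n + 1) i := by
      intro i
      have hi := i.2
      apply Equiv.swap_apply_of_ne_of_ne <;>
      · intro hc
        have := congrArg Fin.val hc
        simp only [Fin.ofNat] at this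
        rw [Nat.mod_eq_of_lt (by omega), Nat.mod_eq_of_lt (by omega)] at this
        omega
    simp only [Function.comp_apply, e, Equiv.swap_apply_right]

theorem sum_sum_freshLoss_le (hβ1 : β ≤ 1) (hA : ∀ m, IsSymmBetween β (A m))
    (hstep : ∀ m w, step m w - wStar = w - wStar - A m (w - wStar)) {n : ℕ}
    (S : Finset (Fin (n + 1) → Fin M)) :
    ∑ τ ∈ S, ∑ i : Fin (n + 1), surrogateLoss A wStar (τ i)
        (lastIterate step w₀ i fun j => τ (j.castLE i.2.le))
      ≤ S.card * ‖w₀ - wStar‖ ^ 2 / (2 - β) := by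
  have h := sum_expectedLoss_le (S := S) (β := β)
    (B := fun t τ => A (τ (Fin.ofNat (n + 1) t)))
    (u := fun t τ => lastIterate step w₀ t (fun i => τ (Fin.ofNat (n + 1) i)) - wStar)
    (fun t τ => hA _) (fun t τ => by
      rw [lastIterate_succ, hstep]
      rfl) (n + 1)
  rw [le_div_iff₀' (by linarith), Finset.sum_comm]
  simp only [lastIterate, Finset.sum_const, nsmul_eq_mul] at h
  rw [Finset.sum_range] at h
  refine (le_of_eq ?_).trans h
  congr 1
  refine Finset.sum_congr rfl fun i _ => Finset.sum_congr rfl fun τ _ => ?_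
  have e : ∀ j : Fin i, Fin.ofNat (n + 1) (j : ℕ) = j.castLE i.2.le := by
    intro j
    ext
    simp [Nat.mod_eq_of_lt (j.2.trans i.2)]
  have e' : Fin.ofNat (n + 1) (i : ℕ) = i := by
    ext
    simp
  simp only [surrogateLoss, e, e']

/-- Skipping one iteration perturbs the last iterate by at most the length of that iteration. -/
theorem norm_lastIterate_sub_lastIterate_succAbove_le (hβ1 : β ≤ 1)
    (hA : ∀ m, IsSymmBetween β (A m))
    (hstep : ∀ m w, step m w - wStar = w - wStar - A m (w - wStar)) (n : ℕ)
    (τ : Fin (n + 1) → Fin M) (i : Fin (n + 1)) :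
    ‖lastIterate step w₀ (n + 1) τ - lastIterate step w₀ n fun j => τ (i.succAbove j)‖
      ≤ ‖A (τ i) ((lastIterate step w₀ i fun j => τ (j.castLE i.2.le)) - wStar)‖ := by
  have hstep' : ∀ m w, step m w = w - A m (w - wStar) := fun m w => by
    rw [← sub_left_inj (a := wStar), hstep]; abel
  induction n with
  | zero =>
    obtain rfl : i = 0 := Fin.fin_one_eq_zero i
    simp [lastIterate, hstep', -map_sub]
  | succ n ih =>
    induction i using Fin.lastCases with
    | last =>
      rw [lastIterate_succ, hstep']
      simp only [Fin.succAbove_last]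
      rw [show ∀ a b : EuclideanSpace ℝ (Fin d), a - b - a = -b by intros; abel, norm_neg]
      exact le_of_eq rfl
    | cast i =>
      have h := ih (fun j => τ j.castSucc) i
      have e : (lastIterate step w₀ (n + 1) fun j => τ (i.castSucc.succAbove j))
          = step (τ (Fin.last (n + 1)))
            (lastIterate step w₀ n fun j => τ (i.succAbove j).castSucc) := by
        simp [lastIterate_succ]
      rw [e, lastIterate_succ, hstep', hstep',
        show ∀ (m : Fin M) (a b : EuclideanSpace ℝ (Fin d)),
          a - A m (a - wStar) - (b - A m (b - wStar)) = (a - b) - A m (a - b) by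
            intro m a b; simp only [map_sub]; abel]
      -- Both runs share the later steps, which are nonexpansive.
      exact ((hA _).norm_sub_apply_le (by linarith) _).trans h

/-- The loss of the last iterate on an already visited task. -/
theorem surrogateLoss_visited_le (hβ0 : 0 ≤ β) (hβ1 : β ≤ 1) (hA : ∀ m, IsSymmBetween β (A m))
    (hstep : ∀ m w, step m w - wStar = w - wStar - A m (w - wStar)) (n : ℕ)
    (τ : Fin (n + 1) → Fin M) (i : Fin (n + 1)) :
    surrogateLoss A wStar (τ i) (lastIterate step w₀ (n + 1) τ)
      ≤ 2 * surrogateLoss A wStar (τ i) (lastIterate step w₀ n fun j => τ (i.succAbove j))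
        + 2 * surrogateLoss A wStar (τ i) (lastIterate step w₀ i fun j => τ (j.castLE i.2.le)) := by
  have h1 := norm_lastIterate_sub_lastIterate_succAbove_le (w₀ := w₀) hβ1 hA hstep n τ i
  set w := lastIterate step w₀ (n + 1) τ
  set w' := lastIterate step w₀ n fun j => τ (i.succAbove j)
  set v := lastIterate step w₀ i fun j => τ (j.castLE i.2.le)
  have h2 := (hA (τ i)).inner_add_le (w' - wStar) (w - w')
  rw [show w' - wStar + (w - w') = w - wStar by abel] at h2
  have h3 := (hA (τ i)).inner_le hβ0 (w - w')
  have h4 := (hA (τ i)).sq_le (v - wStar)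
  have h5 := pow_le_pow_left₀ (norm_nonneg _) h1 2
  have h6 := (hA (τ i)).nonneg (v - wStar)
  unfold surrogateLoss
  -- The deletion error has length at most ‖A v‖, v being the error before step i, and ‖A v‖² ≤ β ⟪A
  -- v, v⟫; β ≤ 1 absorbs both factors β.
  have h7 : β * ‖w - w'‖ ^ 2 ≤ inner ℝ (A (τ i) (v - wStar)) (v - wStar) := by
    calc β * ‖w - w'‖ ^ 2 ≤ 1 * ‖w - w'‖ ^ 2 := by gcongr
      _ ≤ β * inner ℝ (A (τ i) (v - wStar)) (v - wStar) := by linarith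
      _ ≤ 1 * inner ℝ (A (τ i) (v - wStar)) (v - wStar) := by gcongr
      _ = _ := one_mul _
  linarith

/-- The constant is 5 = 2 · 3/2 + 2: shortened runs, for which the deleted task is fresh, plus
deletion errors, which the energy bound sums. -/
theorem sum_visitedLoss_le (hβ0 : 0 ≤ β) (hβ1 : β ≤ 1) (hA : ∀ m, IsSymmBetween β (A m))
    (hstep : ∀ m w, step m w - wStar = w - wStar - A m (w - wStar)) {n : ℕ}
    {S : Finset (Fin (n + 1) → Fin M)} (hS : PermInvariant S) :
    ∑ τ ∈ S, ∑ i, surrogateLoss A wStar (τ i) (lastIterate step w₀ (n + 1) τ)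
      ≤ 5 * (n + 1) * (S.card * ‖w₀ - wStar‖ ^ 2)
        / ((2 - β) * ((n + 1 : ℕ) : ℝ) ^ ((1 - β / 2) ^ 2)) := by
  have hfresh : ∀ i : Fin (n + 1), ∑ τ ∈ S,
      surrogateLoss A wStar (τ i) (lastIterate step w₀ n fun j => τ (i.succAbove j))
      ≤ 3 / 2 * (S.card * ‖w₀ - wStar‖ ^ 2)
        / ((2 - β) * ((n + 1 : ℕ) : ℝ) ^ ((1 - β / 2) ^ 2)) := by
    intro i
    refine le_trans (le_of_eq ?_)
      (sum_freshLoss_le (w₀ := w₀) hβ0 hβ1 hA hstep hS (k := n + 1) (by omega) le_rfl)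
    -- This permutation moves entry i to the end and keeps the order of the others.
    rw [← hS.sum_comp ((finSuccEquiv' (Fin.last n)).trans (finSuccEquiv' i).symm) fun τ =>
      surrogateLoss A wStar (τ (Fin.last n)) (lastIterate step w₀ n fun j => τ j.castSucc)]
    refine Finset.sum_congr rfl fun τ _ => ?_
    have e : ∀ j : Fin n, finSuccEquiv' (Fin.last n) j.castSucc = some j := fun j => by
      rw [← Fin.succAbove_last_apply, finSuccEquiv'_succAbove]
    simp [e]
  set q := (1 - β / 2) ^ 2
  have hq : q ≤ 1 := by
    change (1 - β / 2) ^ 2 ≤ 1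
    nlinarith
  have hk : (0 : ℝ) < ((n + 1 : ℕ) : ℝ) := by positivity
  have hkq : 0 < ((n + 1 : ℕ) : ℝ) ^ q := Real.rpow_pos_of_pos hk q
  have hkq' : ((n + 1 : ℕ) : ℝ) ^ q ≤ n + 1 := by
    calc ((n + 1 : ℕ) : ℝ) ^ q ≤ ((n + 1 : ℕ) : ℝ) ^ (1 : ℝ) :=
          Real.rpow_le_rpow_of_exponent_le (by exact_mod_cast Nat.le_add_left 1 n) hq
      _ = n + 1 := by rw [Real.rpow_one]; push_cast; rfl
  have hβ2 : 0 < 2 - β := by linarith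
  set K := (S.card : ℝ) * ‖w₀ - wStar‖ ^ 2 with hK
  have hK0 : 0 ≤ K := by positivity
  have h1 := sum_sum_freshLoss_le (w₀ := w₀) hβ1 hA hstep S
  -- The energy bound is on the whole sum, hence O(1/(n + 1)) per task; this is no worse than the
  -- rate since q ≤ 1.
  have h2 : K / (2 - β) ≤ (n + 1) * K / ((2 - β) * ((n + 1 : ℕ) : ℝ) ^ q) := by
    rw [div_le_div_iff₀ hβ2 (by positivity)]
    nlinarith [mul_le_mul_of_nonneg_left hkq' (mul_nonneg hK0 hβ2.le)]
  have h3 : ∑ i : Fin (n + 1), ∑ τ ∈ S,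
      surrogateLoss A wStar (τ i) (lastIterate step w₀ n fun j => τ (i.succAbove j))
      ≤ (n + 1) * (3 / 2 * K / ((2 - β) * ((n + 1 : ℕ) : ℝ) ^ q)) := by
    refine (Finset.sum_le_sum fun i _ => hfresh i).trans (le_of_eq ?_)
    simp
  rw [Finset.sum_comm] at h3
  calc ∑ τ ∈ S, ∑ i, surrogateLoss A wStar (τ i) (lastIterate step w₀ (n + 1) τ)
      ≤ ∑ τ ∈ S, ∑ i : Fin (n + 1), (2 * surrogateLoss A wStar (τ i)
            (lastIterate step w₀ n fun j => τ (i.succAbove j))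
          + 2 * surrogateLoss A wStar (τ i)
            (lastIterate step w₀ i fun j => τ (j.castLE i.2.le))) :=
        Finset.sum_le_sum fun τ _ => Finset.sum_le_sum fun i _ =>
          surrogateLoss_visited_le hβ0 hβ1 hA hstep n τ i
    _ ≤ 2 * ((n + 1) * (3 / 2 * K / ((2 - β) * ((n + 1 : ℕ) : ℝ) ^ q)))
        + 2 * ((n + 1) * K / ((2 - β) * ((n + 1 : ℕ) : ℝ) ^ q)) := by
        simp only [Finset.sum_add_distrib, ← Finset.mul_sum]
        linarith
    _ = _ := by ring

end Iterates

/-! ### Spectral functions of Xᵀ X -/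

section Spectral

variable {d : ℕ} {F : Type*} [NormedAddCommGroup F] [InnerProductSpace ℝ F] [CompleteSpace F]

theorem exists_isSymmBetween_repr (b : OrthonormalBasis (Fin d) ℝ (EuclideanSpace ℝ (Fin d)))
    {a : Fin d → ℝ} {β : ℝ} (ha0 : ∀ i, 0 ≤ a i) (haβ : ∀ i, a i ≤ β) :
    ∃ A : EuclideanSpace ℝ (Fin d) →ₗ[ℝ] EuclideanSpace ℝ (Fin d), IsSymmBetween β A ∧
      (∀ v i, b.repr (A v) i = a i * b.repr v i) ∧
      ∀ v, inner ℝ (A v) v = ∑ i, a i * b.repr v i ^ 2 := by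
  let A : EuclideanSpace ℝ (Fin d) →ₗ[ℝ] EuclideanSpace ℝ (Fin d) :=
    Matrix.toLin b.toBasis b.toBasis (Matrix.diagonal a)
  have hrepr : ∀ v i, b.repr (A v) i = a i * b.repr v i := by
    intro v i
    have h := Matrix.toLin_apply b.toBasis b.toBasis (Matrix.diagonal a) v
    simp only [Matrix.mulVec_diagonal, OrthonormalBasis.coe_toBasis] at h
    rw [show A v = _ from h]
    simp only [map_sum, map_smul, OrthonormalBasis.repr_self]
    simp [Pi.single_apply]
  have hinner : ∀ v w, inner ℝ (A v) w = ∑ i, a i * b.repr v i * b.repr w i := by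
    intro v w
    rw [← b.repr.inner_map_map, PiLp.inner_apply]
    refine Finset.sum_congr rfl fun i _ => ?_
    rw [hrepr]
    simp [mul_comm]
  have hinner' : ∀ v, inner ℝ (A v) v = ∑ i, a i * b.repr v i ^ 2 := fun v => by
    rw [hinner]
    exact Finset.sum_congr rfl fun i _ => by ring
  refine ⟨A, ⟨fun v w => ?_, fun v => ?_, fun v => ?_⟩, hrepr, hinner'⟩
  · rw [hinner, real_inner_comm, hinner]
    exact Finset.sum_congr rfl fun i _ => by ring
  · rw [hinner']
    exact Finset.sum_nonneg fun i _ => mul_nonneg (ha0 i) (sq_nonneg _)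
  · rw [hinner', ← b.repr.norm_map, EuclideanSpace.real_norm_sq_eq, Finset.mul_sum]
    refine Finset.sum_le_sum fun i _ => ?_
    rw [hrepr]
    have h1 := mul_le_mul_of_nonneg_right (haβ i) (ha0 i)
    nlinarith [mul_le_mul_of_nonneg_right h1 (sq_nonneg (b.repr v i))]

/-- The spectral function `g (X† X)`, for `g` with `0 ≤ g s ≤ β` and `s ≤ κ * g s` on
`[0, R ^ 2]`. -/
theorem exists_isSymmBetween_spectral (X : EuclideanSpace ℝ (Fin d) →L[ℝ] F) {R β κ : ℝ}
    (hR : ‖X‖ ≤ R) {g : ℝ → ℝ}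
    (hg : ∀ s, 0 ≤ s → s ≤ R ^ 2 → 0 ≤ g s ∧ g s ≤ β ∧ s ≤ κ * g s) :
    ∃ (A : EuclideanSpace ℝ (Fin d) →ₗ[ℝ] EuclideanSpace ℝ (Fin d))
      (b : OrthonormalBasis (Fin d) ℝ (EuclideanSpace ℝ (Fin d))) (s : Fin d → ℝ),
      IsSymmBetween β A ∧ (∀ v, ‖X v‖ ^ 2 ≤ κ * inner ℝ (A v) v) ∧ (∀ i, 0 ≤ s i) ∧
      (∀ v i, b.repr (X.adjoint (X v)) i = s i * b.repr v i) ∧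
      ∀ v i, b.repr (A v) i = g (s i) * b.repr v i := by
  have hsymm : ((X.adjoint ∘L X : EuclideanSpace ℝ (Fin d) →L[ℝ] EuclideanSpace ℝ (Fin d)) :
      EuclideanSpace ℝ (Fin d) →ₗ[ℝ] EuclideanSpace ℝ (Fin d)).IsSymmetric := by
    intro v w
    simp [ContinuousLinearMap.adjoint_inner_left, ContinuousLinearMap.adjoint_inner_right]
  have hn : Module.finrank ℝ (EuclideanSpace ℝ (Fin d)) = d := finrank_euclideanSpace_fin
  let b := hsymm.eigenvectorBasis hn
  let s := hsymm.eigenvalues hn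
  have hs : ∀ v i, b.repr (X.adjoint (X v)) i = s i * b.repr v i := fun v i =>
    hsymm.eigenvectorBasis_apply_self_apply hn v i
  have hX : ∀ v, ‖X v‖ ^ 2 = ∑ i, s i * b.repr v i ^ 2 := by
    intro v
    rw [← real_inner_self_eq_norm_sq, ← ContinuousLinearMap.adjoint_inner_left,
      ← b.repr.inner_map_map, PiLp.inner_apply]
    refine Finset.sum_congr rfl fun i _ => ?_
    rw [hs]
    simp
    ring
  -- This places the eigenvalues in [0, R²], where the hypotheses on g apply.
  have hsi : ∀ i, s i = ‖X (b i)‖ ^ 2 := fun i => by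
    rw [hX, Finset.sum_eq_single i]
    · simp
    · intro j _ hj
      simp [hj]
    · simp
  have hs0 : ∀ i, 0 ≤ s i := fun i => by rw [hsi]; positivity
  have hsR : ∀ i, s i ≤ R ^ 2 := fun i => by
    rw [hsi]
    refine pow_le_pow_left₀ (norm_nonneg _) ?_ 2
    have h := X.le_opNorm (b i)
    rw [b.norm_eq_one, mul_one] at h
    exact h.trans hR
  obtain ⟨A, hA, hrepr, hinner⟩ := exists_isSymmBetween_repr b (a := fun i => g (s i))
    (fun i => (hg _ (hs0 i) (hsR i)).1) (fun i => (hg _ (hs0 i) (hsR i)).2.1)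
  refine ⟨A, b, s, hA, fun v => ?_, hs0, hs, hrepr⟩
  rw [hX, hinner, Finset.mul_sum]
  refine Finset.sum_le_sum fun i _ => ?_
  rw [← mul_assoc]
  exact mul_le_mul_of_nonneg_right (hg _ (hs0 i) (hsR i)).2.2 (sq_nonneg _)

end Spectral

/-! ### Both schemes as surrogate gradient steps -/

namespace TaskCollection

variable {d M : ℕ} (T : TaskCollection d M)

/-- The iterations `step m` are gradient steps of size `1` on the quadratic surrogate losses
`⟪A m (w - wStar), w - wStar⟫ / 2`, which dominate the task losses up to the factor `κ`. -/
structure IsSurrogate (step : Fin M → EuclideanSpace ℝ (Fin d) → EuclideanSpace ℝ (Fin d))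
    (wStar : EuclideanSpace ℝ (Fin d)) (β κ : ℝ)
    (A : Fin M → EuclideanSpace ℝ (Fin d) →ₗ[ℝ] EuclideanSpace ℝ (Fin d)) : Prop where
  symmBetween : ∀ m, IsSymmBetween β (A m)
  step_sub : ∀ m w, step m w - wStar = w - wStar - A m (w - wStar)
  norm_op_sq_le : ∀ m v, ‖T.op m v‖ ^ 2 ≤ κ * inner ℝ (A m v) v

theorem norm_op_le_radius (m : Fin M) : ‖T.op m‖ ≤ T.radius :=
  le_ciSup (f := fun m => ‖T.op m‖) (Set.finite_range _).bddAbove m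

variable {T} {wStar : EuclideanSpace ℝ (Fin d)}

/-- First-order optimality. Moving from the minimiser by t times the gradient G changes the
objective by t ‖G‖² + t² K, which is nonnegative for every t only if G = 0. -/
theorem adjoint_regularizedStep {lam : ℝ} (hlam : 0 < lam) (hT : T.IsOfflineSolution wStar)
    (m : Fin M) (w : EuclideanSpace ℝ (Fin d)) :
    (T.op m).adjoint (T.op m (T.regularizedStep lam m w - wStar))
      + lam • (T.regularizedStep lam m w - w) = 0 := by
  set v := T.regularizedStep lam m w with hv
  have hmin := T.isMinOn_regularizedStep hlam m w
  rw [← hv] at hmin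
  set G := (T.op m).adjoint (T.op m (v - wStar)) + lam • (v - w) with hG
  have hinner : ∀ h, inner ℝ G h
      = inner ℝ (T.op m v - T.y m) (T.op m h) + lam * inner ℝ (v - w) h := by
    intro h
    rw [hG, inner_add_left, ContinuousLinearMap.adjoint_inner_left, map_sub, hT m,
      real_inner_smul_left]
  have hexp : ∀ t : ℝ, 0 ≤ t * ‖G‖ ^ 2
      + t * t * ((1 / 2) * ‖T.op m G‖ ^ 2 + lam / 2 * ‖G‖ ^ 2) := by
    intro t
    have h : T.regularizedObjective lam m w v ≤ T.regularizedObjective lam m w (v + t • G) :=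
      hmin (Set.mem_univ _)
    simp only [regularizedObjective] at h
    rw [show T.op m (v + t • G) - T.y m = (T.op m v - T.y m) + t • T.op m G by
        rw [map_add, map_smul]; abel,
      show v + t • G - w = (v - w) + t • G by abel, norm_add_sq_real, norm_add_sq_real,
      norm_smul, norm_smul, inner_smul_right, inner_smul_right, mul_pow, mul_pow,
      Real.norm_eq_abs, sq_abs] at h
    have h' := congrArg (fun x => t * x) (hinner G)
    simp only [real_inner_self_eq_norm_sq] at h'
    rw [h']
    linarith
  by_contra hne
  have hpos : 0 < ‖G‖ ^ 2 := by positivity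
  set K := (1 / 2) * ‖T.op m G‖ ^ 2 + lam / 2 * ‖G‖ ^ 2 with hK
  have hKpos : 0 < K := by positivity
  -- The minimiser of the quadratic in t.
  have h := hexp (-(‖G‖ ^ 2 / (2 * K)))
  have e : -(‖G‖ ^ 2 / (2 * K)) * ‖G‖ ^ 2
      + -(‖G‖ ^ 2 / (2 * K)) * -(‖G‖ ^ 2 / (2 * K)) * K = -((‖G‖ ^ 2) ^ 2 / (4 * K)) := by
    field_simp
    ring
  rw [e] at h
  have : 0 < (‖G‖ ^ 2) ^ 2 / (4 * K) := by positivity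
  linarith

/-- In an eigendirection of Xᵀ X with eigenvalue s, the optimality condition multiplies the error by
λ / (s + λ) = 1 - g(s). Here s = (s + λ) g(s), whence κ = R² + λ. -/
theorem exists_isSurrogate_regularizedStep {lam : ℝ} (hlam : 0 < lam)
    (hT : T.IsOfflineSolution wStar) :
    ∃ A, T.IsSurrogate (T.regularizedStep lam) wStar (T.radius ^ 2 / (T.radius ^ 2 + lam))
      (T.radius ^ 2 + lam) A := by
  choose A b s hA hop hs hX hrepr using fun m => exists_isSymmBetween_spectral (T.op m)
    (T.norm_op_le_radius m) (g := fun s => s / (s + lam))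
    (β := T.radius ^ 2 / (T.radius ^ 2 + lam)) (κ := T.radius ^ 2 + lam) (by
      intro s hs hsR
      have h1 : 0 < s + lam := by positivity
      have h2 : 0 < T.radius ^ 2 + lam := by positivity
      refine ⟨by positivity, ?_, ?_⟩
      · rw [div_le_div_iff₀ h1 h2]
        nlinarith
      · rw [mul_div_assoc', le_div_iff₀ h1]
        nlinarith)
  refine ⟨A, hA, fun m w => ?_, hop⟩
  apply (b m).repr.injective
  ext i
  have h := congrArg (fun v => (b m).repr v i) (adjoint_regularizedStep hlam hT m w)
  set v := T.regularizedStep lam m w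
  rw [show lam • (v - w) = lam • (v - wStar) - lam • (w - wStar) by module] at h
  simp only [map_add, map_sub _ (lam • _), map_smul, PiLp.add_apply, PiLp.sub_apply,
    PiLp.smul_apply, hX, smul_eq_mul, map_zero, PiLp.zero_apply] at h
  rw [map_sub _ (w - wStar), PiLp.sub_apply, hrepr]
  have h1 : 0 < s m i + lam := by linarith [hs m i]
  field_simp
  linarith

theorem gradient_taskLoss (hT : T.IsOfflineSolution wStar) (m : Fin M)
    (w : EuclideanSpace ℝ (Fin d)) :
    gradient (T.taskLoss m) w = (T.op m).adjoint (T.op m (w - wStar)) := by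
  apply HasGradientAt.gradient
  rw [hasGradientAt_iff_hasFDerivAt]
  have h1 : HasFDerivAt (fun v => T.op m v - T.y m) (T.op m) w :=
    (T.op m).hasFDerivAt.sub_const _
  have h2 := (h1.norm_sq).const_mul (1 / 2 : ℝ)
  refine h2.congr_fderiv ?_
  ext v
  simp [ContinuousLinearMap.adjoint_inner_left, map_sub, hT m]

/-- Each gradient step multiplies the eigencomponent by 1 - γ s, so N of them give 1 - g(s). The
factor κ = R² / g(R²) is the largest value of s / g(s). -/
theorem exists_isSurrogate_budgetedStep {γ : ℝ} {N : ℕ} (hγ : γ ∈ Set.Ioo 0 (1 / T.radius ^ 2))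
    (hN : 1 ≤ N) (hT : T.IsOfflineSolution wStar) :
    ∃ A, T.IsSurrogate (T.budgetedStep γ N) wStar (1 - (1 - γ * T.radius ^ 2) ^ N)
      (T.radius ^ 2 / (1 - (1 - γ * T.radius ^ 2) ^ N)) A := by
  -- For radius 0 the interval for γ is empty, as 1 / 0 = 0.
  have hR : 0 < T.radius ^ 2 := by
    have := hγ.1.trans hγ.2
    rwa [one_div, inv_pos] at this
  have hγ0 := hγ.1
  have hγR : γ * T.radius ^ 2 < 1 := by
    have := hγ.2
    rwa [lt_div_iff₀ hR] at this
  have hr0 : 0 ≤ 1 - γ * T.radius ^ 2 := by linarith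
  have hr1 : 1 - γ * T.radius ^ 2 < 1 := by linarith [mul_pos hγ0 hR]
  have hβ : 0 < 1 - (1 - γ * T.radius ^ 2) ^ N := by
    linarith [pow_lt_one₀ hr0 hr1 (by omega : N ≠ 0)]
  choose A b s hA hop hs hX hrepr using fun m => exists_isSymmBetween_spectral (T.op m)
    (T.norm_op_le_radius m) (g := fun s => 1 - (1 - γ * s) ^ N)
    (β := 1 - (1 - γ * T.radius ^ 2) ^ N)
    (κ := T.radius ^ 2 / (1 - (1 - γ * T.radius ^ 2) ^ N)) (by
      intro s hs hsR
      have h1 : γ * s ≤ γ * T.radius ^ 2 := mul_le_mul_of_nonneg_left hsR hγ0.le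
      have h0 : 0 ≤ γ * s := by positivity
      refine ⟨?_, ?_, ?_⟩
      · linarith [pow_le_one₀ (n := N) (by linarith : 0 ≤ 1 - γ * s) (by linarith)]
      · linarith [pow_le_pow_left₀ hr0 (by linarith : 1 - γ * T.radius ^ 2 ≤ 1 - γ * s) N]
      · rw [div_mul_eq_mul_div, le_div_iff₀ hβ]
        -- The geometric sum shows that g(s) / s is γ ∑ (1 - γ s)^i, which decreases in s.
        have e1 := geom_sum_mul_neg (1 - γ * s) N
        have e2 := geom_sum_mul_neg (1 - γ * T.radius ^ 2) N
        rw [← e1, ← e2]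
        have h2 : ∑ i ∈ Finset.range N, (1 - γ * T.radius ^ 2) ^ i
            ≤ ∑ i ∈ Finset.range N, (1 - γ * s) ^ i :=
          Finset.sum_le_sum fun i _ => pow_le_pow_left₀ hr0 (by linarith) i
        have h3 : 0 ≤ γ * s * T.radius ^ 2 := by positivity
        nlinarith [mul_le_mul_of_nonneg_left h2 h3])
  refine ⟨A, hA, fun m w => ?_, hop⟩
  apply (b m).repr.injective
  ext i
  have key : ∀ n, (b m).repr (T.budgetedStep γ n m w - wStar) i
      = (1 - γ * s m i) ^ n * (b m).repr (w - wStar) i := by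
    intro n
    induction n with
    | zero => simp [budgetedStep]
    | succ n ih =>
      have e : T.budgetedStep γ (n + 1) m w = T.budgetedStep γ n m w
          - γ • (T.op m).adjoint (T.op m (T.budgetedStep γ n m w - wStar)) := by
        rw [budgetedStep, Function.iterate_succ_apply', gradient_taskLoss hT]
        rfl
      rw [e, sub_right_comm, map_sub _ (_ - wStar), PiLp.sub_apply, map_smul, PiLp.smul_apply, hX,
        ih, smul_eq_mul]
      ring
  rw [key, map_sub _ (w - wStar), PiLp.sub_apply, hrepr]
  ring

end TaskCollection

/-! ### Uniform laws on orderings -/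

section Orderings

theorem integral_uniformOn_finset {α : Type*} [Fintype α] [MeasurableSpace α]
    [MeasurableSingletonClass α] (S : Finset α) (f : α → ℝ) :
    ∫ x, f x ∂(uniformOn (S : Set α)) = (∑ x ∈ S, f x) / S.card := by
  classical
  have : IsFiniteMeasure (uniformOn (S : Set α)) := by
    rw [uniformOn]; infer_instance
  rw [integral_fintype (Integrable.of_finite), Finset.sum_div,
    ← Finset.sum_subset (Finset.subset_univ S)]
  · refine Finset.sum_congr rfl fun x hx => ?_
    rw [measureReal_def, ← Finset.coe_singleton, uniformOn_apply_finset,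
      Finset.inter_singleton_of_mem hx]
    simp [div_eq_inv_mul]
  · intro x _ hx
    rw [measureReal_def, ← Finset.coe_singleton, uniformOn_apply_finset,
      Finset.inter_singleton_of_notMem hx]
    simp

theorem withReplacement_eq (M k : ℕ) :
    withReplacement M k = uniformOn ((Finset.univ : Finset (Fin k → Fin M)) : Set _) := by
  rw [withReplacement, ← uniformOn_pi, Finset.coe_univ, Set.pi_univ]

open Classical in
/-- The orderings of length `k` without repetition. -/
noncomputable def injectiveTuples (M k : ℕ) : Finset (Fin k → Fin M) :=
  Finset.univ.filter Function.Injective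

theorem mem_injectiveTuples {M k : ℕ} {τ : Fin k → Fin M} :
    τ ∈ injectiveTuples M k ↔ Function.Injective τ := by
  simp [injectiveTuples]

theorem withoutReplacement_eq (M k : ℕ) :
    withoutReplacement M k = uniformOn (injectiveTuples M k : Set (Fin k → Fin M)) := by
  simp [withoutReplacement, injectiveTuples]

theorem permInvariant_univ (M k : ℕ) :
    PermInvariant (Finset.univ : Finset (Fin k → Fin M)) := fun _ _ _ => Finset.mem_univ _

theorem permInvariant_injectiveTuples (M k : ℕ) : PermInvariant (injectiveTuples M k) :=
  fun _ hτ σ => mem_injectiveTuples.2 ((mem_injectiveTuples.1 hτ).comp σ.injective)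

theorem injectiveTuples_nonempty {M k : ℕ} (h : k ≤ M) : (injectiveTuples M k).Nonempty :=
  ⟨Fin.castLE h, mem_injectiveTuples.2 (Fin.castLE_injective h)⟩

/-- Turns the fresh loss over orderings of length k + 1 into the sum over all tasks of the loss
after k steps. -/
theorem sum_snoc {M k : ℕ} (f : (Fin k → Fin M) → Fin M → ℝ) :
    ∑ τ : Fin (k + 1) → Fin M, f (fun i => τ i.castSucc) (τ (Fin.last k))
      = ∑ τ, ∑ m, f τ m := by
  rw [← (Fin.snocEquiv fun _ => Fin M).sum_comp, Fintype.sum_prod_type, Finset.sum_comm]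
  simp [Fin.snocEquiv]

open Classical in
theorem sum_injectiveTuples_succ {M k : ℕ} (f : (Fin k → Fin M) → Fin M → ℝ) :
    ∑ τ ∈ injectiveTuples M (k + 1), f (fun i => τ i.castSucc) (τ (Fin.last k))
      = ∑ τ ∈ injectiveTuples M k, ∑ m ∈ (Finset.univ.image τ)ᶜ, f τ m := by
  have h : ∀ τ : Fin (k + 1) → Fin M, Function.Injective τ ↔
      Function.Injective (fun i : Fin k => τ i.castSucc) ∧
        τ (Fin.last k) ∈ (Finset.univ.image fun i : Fin k => τ i.castSucc)ᶜ := by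
    intro τ
    conv_lhs => rw [← Fin.snoc_init_self τ]
    rw [Fin.snoc_injective_iff]
    simp [Fin.init_def, Set.mem_range]
  rw [injectiveTuples, Finset.sum_filter]
  simp only [h]
  rw [sum_snoc fun τ m => if Function.Injective τ ∧ m ∈ (Finset.univ.image τ)ᶜ then f τ m else 0,
    injectiveTuples, Finset.sum_filter]
  refine Finset.sum_congr rfl fun τ _ => ?_
  split_ifs with hτ
  · simp only [hτ, true_and]
    rw [← Finset.sum_filter, Finset.filter_univ_mem]
  · simp [hτ]

end Orderings

/-! ### Expected loss under the two laws -/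

section Rates

variable {d M k : ℕ} {T : TaskCollection d M} {w₀ wStar : EuclideanSpace ℝ (Fin d)}
  {step : Fin M → EuclideanSpace ℝ (Fin d) → EuclideanSpace ℝ (Fin d)} {β κ : ℝ}
  {A : Fin M → EuclideanSpace ℝ (Fin d) →ₗ[ℝ] EuclideanSpace ℝ (Fin d)}

theorem averageLoss_le (hT : T.IsOfflineSolution wStar) (hA : T.IsSurrogate step wStar β κ A)
    (w : EuclideanSpace ℝ (Fin d)) :
    T.averageLoss w ≤ κ / 2 / M * ∑ m, surrogateLoss A wStar m w := by
  rw [TaskCollection.averageLoss, Finset.mul_sum, Finset.mul_sum]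
  refine Finset.sum_le_sum fun m _ => ?_
  have h := hA.norm_op_sq_le m (w - wStar)
  rw [map_sub, hT m] at h
  rw [TaskCollection.taskLoss, surrogateLoss]
  calc 1 / (M : ℝ) * (1 / 2 * ‖T.op m w - T.y m‖ ^ 2)
      ≤ 1 / (M : ℝ) * (1 / 2 * (κ * inner ℝ (A m (w - wStar)) (w - wStar))) := by gcongr
    _ = _ := by ring

theorem integral_averageLoss_le (hT : T.IsOfflineSolution wStar)
    (hA : T.IsSurrogate step wStar β κ A) (S : Finset (Fin k → Fin M)) :
    ∫ τ, T.averageLoss (lastIterate step w₀ k τ) ∂(uniformOn (S : Set (Fin k → Fin M)))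
      ≤ κ / 2 / M * (∑ τ ∈ S, ∑ m, surrogateLoss A wStar m (lastIterate step w₀ k τ))
        / S.card := by
  rw [integral_uniformOn_finset, Finset.mul_sum]
  gcongr
  exact averageLoss_le hT hA _

theorem integral_withReplacement_le (hβ0 : 0 ≤ β) (hβ1 : β ≤ 1) (hκ : 0 ≤ κ) (hM : 1 ≤ M)
    (hk : 1 ≤ k) (hT : T.IsOfflineSolution wStar) (hA : T.IsSurrogate step wStar β κ A) :
    ∫ τ, T.averageLoss (lastIterate step w₀ k τ) ∂(withReplacement M k)
      ≤ Real.exp 1 * ‖w₀ - wStar‖ ^ 2 * κ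
        / (2 * (2 - β) * (k : ℝ) ^ ((1 - β / 2) ^ 2)) := by
  have hM' : (0 : ℝ) < M := by exact_mod_cast hM
  have hk' : (0 : ℝ) < k := by exact_mod_cast hk
  have hkq := Real.rpow_pos_of_pos hk' ((1 - β / 2) ^ 2)
  have hβ2 : 0 < 2 - β := by linarith
  rw [withReplacement_eq]
  refine (integral_averageLoss_le hT hA _).trans ?_
  -- Orderings have length k + 1: k steps and one independent test task.
  have h := sum_freshLoss_le (w₀ := w₀) hβ0 hβ1 hA.symmBetween hA.step_sub
    (permInvariant_univ M (k + 1)) hk (by omega)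
  rw [sum_snoc fun τ m => surrogateLoss A wStar m (lastIterate step w₀ k τ)] at h
  simp only [Finset.card_univ, Fintype.card_fun, Fintype.card_fin] at h ⊢
  calc κ / 2 / M * (∑ τ, ∑ m, surrogateLoss A wStar m (lastIterate step w₀ k τ))
        / ((M ^ k : ℕ) : ℝ)
      ≤ κ / 2 / M * (3 / 2 * (((M ^ (k + 1) : ℕ) : ℝ) * ‖w₀ - wStar‖ ^ 2)
        / ((2 - β) * (k : ℝ) ^ ((1 - β / 2) ^ 2))) / ((M ^ k : ℕ) : ℝ) := by gcongr
    _ = 3 / 2 * ‖w₀ - wStar‖ ^ 2 * κ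
        / (2 * (2 - β) * (k : ℝ) ^ ((1 - β / 2) ^ 2)) := by
        push_cast
        field_simp
        ring
    _ ≤ _ := by
        gcongr
        linarith [Real.exp_one_gt_d9]

theorem integral_withoutReplacement_le (hβ0 : 0 ≤ β) (hβ1 : β ≤ 1) (hκ : 0 ≤ κ) (hk : 1 ≤ k)
    (hkM : k ≤ M) (hT : T.IsOfflineSolution wStar) (hA : T.IsSurrogate step wStar β κ A) :
    ∫ τ, T.averageLoss (lastIterate step w₀ k τ) ∂(withoutReplacement M k)
      ≤ 2 * (Real.exp 1 * ‖w₀ - wStar‖ ^ 2 * κ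
        / (2 * (2 - β) * (k : ℝ) ^ ((1 - β / 2) ^ 2))) := by
  classical
  obtain ⟨n, rfl⟩ : ∃ n, k = n + 1 := ⟨k - 1, by omega⟩
  have hM' : (0 : ℝ) < M := by exact_mod_cast hk.trans hkM
  have hk' : (0 : ℝ) < ((n + 1 : ℕ) : ℝ) := by exact_mod_cast hk
  have hkq := Real.rpow_pos_of_pos hk' ((1 - β / 2) ^ 2)
  have hβ2 : 0 < 2 - β := by linarith
  set S := injectiveTuples M (n + 1) with hS
  -- If k = M there is no unseen task: both sides vanish and the fresh bound is trivial.
  have hcard : ((injectiveTuples M (n + 1 + 1)).card : ℝ) = S.card * (M - (n + 1)) := by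
    have h := sum_injectiveTuples_succ (M := M) (k := n + 1) fun _ _ => 1
    rw [Finset.sum_const, nsmul_eq_mul, mul_one] at h
    rw [h, ← nsmul_eq_mul, ← Finset.sum_const]
    refine Finset.sum_congr rfl fun τ hτ => ?_
    rw [Finset.sum_const, nsmul_eq_mul, mul_one, Finset.card_compl,
      Finset.card_image_of_injective _ (mem_injectiveTuples.1 hτ), Finset.card_univ,
      Fintype.card_fin, Fintype.card_fin, Nat.cast_sub hkM]
    push_cast
    rfl
  have h1 := sum_freshLoss_le (w₀ := w₀) hβ0 hβ1 hA.symmBetween hA.step_sub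
    (permInvariant_injectiveTuples M (n + 1 + 1)) hk (by omega)
  rw [sum_injectiveTuples_succ fun τ m => surrogateLoss A wStar m (lastIterate step w₀ (n + 1) τ),
    hcard] at h1
  have h2 := sum_visitedLoss_le (w₀ := w₀) hβ0 hβ1 hA.symmBetween hA.step_sub
    (permInvariant_injectiveTuples M (n + 1))
  have hS0 : (0 : ℝ) < S.card := by
    exact_mod_cast (injectiveTuples_nonempty hkM).card_pos
  have hMn : (0 : ℝ) ≤ M - (n + 1) := by
    have : ((n + 1 : ℕ) : ℝ) ≤ M := by exact_mod_cast hkM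
    push_cast at this
    linarith
  rw [withoutReplacement_eq]
  refine (integral_averageLoss_le hT hA _).trans ?_
  have hsplit : ∑ τ ∈ S, ∑ m, surrogateLoss A wStar m (lastIterate step w₀ (n + 1) τ)
      = (∑ τ ∈ S, ∑ i, surrogateLoss A wStar (τ i) (lastIterate step w₀ (n + 1) τ))
        + ∑ τ ∈ S, ∑ m ∈ (Finset.univ.image τ)ᶜ,
          surrogateLoss A wStar m (lastIterate step w₀ (n + 1) τ) := by
    rw [← Finset.sum_add_distrib]
    refine Finset.sum_congr rfl fun τ hτ => ?_
    rw [← Finset.sum_add_sum_compl (Finset.univ.image τ),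
      Finset.sum_image fun i _ j _ h => mem_injectiveTuples.1 hτ h]
  set X := ‖w₀ - wStar‖ ^ 2 / ((2 - β) * ((n + 1 : ℕ) : ℝ) ^ ((1 - β / 2) ^ 2)) with hX
  have hX0 : 0 ≤ X := by positivity
  have h3 : ∑ τ ∈ S, ∑ m, surrogateLoss A wStar m (lastIterate step w₀ (n + 1) τ)
      ≤ 5 * (S.card * M) * X := by
    rw [hsplit]
    have e1 : 5 * ((n : ℝ) + 1) * (S.card * ‖w₀ - wStar‖ ^ 2)
        / ((2 - β) * ((n + 1 : ℕ) : ℝ) ^ ((1 - β / 2) ^ 2)) = 5 * (S.card * (n + 1)) * X := by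
      rw [hX]; ring
    have e2 : 3 / 2 * (S.card * ((M : ℝ) - (n + 1)) * ‖w₀ - wStar‖ ^ 2)
        / ((2 - β) * ((n + 1 : ℕ) : ℝ) ^ ((1 - β / 2) ^ 2))
        = 3 / 2 * (S.card * ((M : ℝ) - (n + 1)) * X) := by
      rw [hX]; ring
    rw [e1] at h2
    rw [e2] at h1
    have h4 : 0 ≤ S.card * ((M : ℝ) - (n + 1)) * X := by positivity
    linarith
  calc κ / 2 / M * (∑ τ ∈ S, ∑ m, surrogateLoss A wStar m (lastIterate step w₀ (n + 1) τ))
        / S.card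
      ≤ κ / 2 / M * (5 * (S.card * M) * X) / S.card := by gcongr
    _ = 5 * (κ / 2 * X) := by field_simp
    -- 5 ≤ 2e, so the absolute constant can be taken to be 2.
    _ ≤ 2 * Real.exp 1 * (κ / 2 * X) := by
        gcongr
        linarith [Real.exp_one_gt_d9]
    _ = _ := by rw [hX]; field_simp

theorem averageLoss_eq_zero_of_radius_eq_zero (hT : T.IsOfflineSolution wStar)
    (hR : T.radius = 0) (w : EuclideanSpace ℝ (Fin d)) : T.averageLoss w = 0 := by
  have hop : ∀ m, T.op m = 0 := fun m =>
    norm_le_zero_iff.1 ((T.norm_op_le_radius m).trans_eq hR)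
  have hy : ∀ m, T.y m = 0 := fun m => by rw [← hT m, hop]; simp
  simp [TaskCollection.averageLoss, TaskCollection.taskLoss, hop, hy]

end Rates

/-! ### The stated bounds in terms of β and κ, using 1 - β (1 - β/4) = (1 - β/2)² -/

theorem regularized_bound_eq {R lam k D : ℝ} (hlam : 0 < lam) (hR : R ≠ 0) :
    Real.exp 1 * D * R ^ 2 /
      (2 * (R ^ 2 / (R ^ 2 + lam)) * (2 - R ^ 2 / (R ^ 2 + lam))
        * k ^ (1 - R ^ 2 / (R ^ 2 + lam) * (1 - R ^ 2 / (4 * (R ^ 2 + lam)))))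
      = Real.exp 1 * D * (R ^ 2 + lam) / (2 * (2 - R ^ 2 / (R ^ 2 + lam))
        * k ^ ((1 - R ^ 2 / (R ^ 2 + lam) / 2) ^ 2)) := by
  have h1 : 0 < R ^ 2 + lam := by positivity
  have e : 1 - R ^ 2 / (R ^ 2 + lam) * (1 - R ^ 2 / (4 * (R ^ 2 + lam)))
      = (1 - R ^ 2 / (R ^ 2 + lam) / 2) ^ 2 := by
    field_simp
    ring
  rw [e]
  have h2 : R ^ 2 = (R ^ 2 + lam) * (R ^ 2 / (R ^ 2 + lam)) := by field_simp
  have h3 : R ^ 2 / (R ^ 2 + lam) ≠ 0 := by positivity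
  generalize R ^ 2 / (R ^ 2 + lam) = β at *
  rw [h2, show Real.exp 1 * D * ((R ^ 2 + lam) * β) = (Real.exp 1 * D * (R ^ 2 + lam)) * β by ring,
    show 2 * β * (2 - β) * k ^ ((1 - β / 2) ^ 2) = (2 * (2 - β) * k ^ ((1 - β / 2) ^ 2)) * β by
      ring, mul_div_mul_right _ _ h3, ← h2]

theorem budgeted_bound_eq {R γ k D : ℝ} (N : ℕ) :
    Real.exp 1 * D * R ^ 2 / (2 * (1 - (1 - γ * R ^ 2) ^ (2 * N))
      * k ^ (1 - (1 - (1 - γ * R ^ 2) ^ N) * (1 - (1 - (1 - γ * R ^ 2) ^ N) / 4)))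
      = Real.exp 1 * D * (R ^ 2 / (1 - (1 - γ * R ^ 2) ^ N))
        / (2 * (2 - (1 - (1 - γ * R ^ 2) ^ N))
        * k ^ ((1 - (1 - (1 - γ * R ^ 2) ^ N) / 2) ^ 2)) := by
  rw [mul_comm 2 N, pow_mul]
  generalize (1 - γ * R ^ 2) ^ N = r
  rw [show 1 - (1 - r) * (1 - (1 - r) / 4) = (1 - (1 - r) / 2) ^ 2 by ring,
    show 1 - r ^ 2 = (1 - r) * (2 - (1 - r)) by ring, mul_div_assoc', div_div]
  congr 1
  ring

theorem budgeted_coeff_mem {R γ : ℝ} (hγ : γ ∈ Set.Ioo 0 (1 / R ^ 2)) (N : ℕ) :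
    0 ≤ 1 - (1 - γ * R ^ 2) ^ N ∧ 1 - (1 - γ * R ^ 2) ^ N ≤ 1 := by
  have hR : 0 < R ^ 2 := by
    have := hγ.1.trans hγ.2
    rwa [one_div, inv_pos] at this
  have hγR : γ * R ^ 2 < 1 := by
    have := hγ.2
    rwa [lt_div_iff₀ hR] at this
  have h0 : 0 ≤ 1 - γ * R ^ 2 := by linarith
  have h1 : 1 - γ * R ^ 2 ≤ 1 := by linarith [mul_pos hγ.1 hR]
  exact ⟨sub_nonneg.2 (pow_le_one₀ h0 h1), by linarith [pow_nonneg h0 N]⟩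

theorem regularized_coeff_mem (R : ℝ) {lam : ℝ} (hlam : 0 < lam) :
    0 ≤ R ^ 2 / (R ^ 2 + lam) ∧ R ^ 2 / (R ^ 2 + lam) ≤ 1 :=
  ⟨by positivity, div_le_one_of_le₀ (by linarith) (by positivity)⟩

end ContinualRegression

theorem mainTheorem4 :
    -- Orderings with replacement.
    (∀ (d M k : ℕ) (T : ContinualRegression.TaskCollection d M)
        (w₀ wStar : EuclideanSpace ℝ (Fin d)),
      1 ≤ M → 1 ≤ k → T.IsOfflineSolution wStar →
      (∀ lam : ℝ, 0 < lam →
        ∫ τ, T.averageLoss (ContinualRegression.lastIterate (T.regularizedStep lam) w₀ k τ)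
            ∂(ContinualRegression.withReplacement M k)
          ≤ Real.exp 1 * ‖w₀ - wStar‖ ^ 2 * T.radius ^ 2 /
            (2 * (T.radius ^ 2 / (T.radius ^ 2 + lam))
              * (2 - T.radius ^ 2 / (T.radius ^ 2 + lam))
              * (k : ℝ) ^ (1 - T.radius ^ 2 / (T.radius ^ 2 + lam)
                  * (1 - T.radius ^ 2 / (4 * (T.radius ^ 2 + lam)))))) ∧
      (∀ (γ : ℝ) (N : ℕ), γ ∈ Set.Ioo 0 (1 / T.radius ^ 2) → 1 ≤ N →
        ∫ τ, T.averageLoss (ContinualRegression.lastIterate (T.budgetedStep γ N) w₀ k τ)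
            ∂(ContinualRegression.withReplacement M k)
          ≤ Real.exp 1 * ‖w₀ - wStar‖ ^ 2 * T.radius ^ 2 /
            (2 * (1 - (1 - γ * T.radius ^ 2) ^ (2 * N))
              * (k : ℝ) ^ (1 - (1 - (1 - γ * T.radius ^ 2) ^ N)
                  * (1 - (1 - (1 - γ * T.radius ^ 2) ^ N) / 4))))) ∧
    -- Orderings without replacement: the same rates, up to an absolute constant.
    (∃ C : ℝ, ∀ (d M k : ℕ) (T : ContinualRegression.TaskCollection d M)
        (w₀ wStar : EuclideanSpace ℝ (Fin d)),
      1 ≤ k → k ≤ M → T.IsOfflineSolution wStar →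
      (∀ lam : ℝ, 0 < lam →
        ∫ τ, T.averageLoss (ContinualRegression.lastIterate (T.regularizedStep lam) w₀ k τ)
            ∂(ContinualRegression.withoutReplacement M k)
          ≤ C * (Real.exp 1 * ‖w₀ - wStar‖ ^ 2 * T.radius ^ 2 /
            (2 * (T.radius ^ 2 / (T.radius ^ 2 + lam))
              * (2 - T.radius ^ 2 / (T.radius ^ 2 + lam))
              * (k : ℝ) ^ (1 - T.radius ^ 2 / (T.radius ^ 2 + lam)
                  * (1 - T.radius ^ 2 / (4 * (T.radius ^ 2 + lam))))))) ∧
      (∀ (γ : ℝ) (N : ℕ), γ ∈ Set.Ioo 0 (1 / T.radius ^ 2) → 1 ≤ N →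
        ∫ τ, T.averageLoss (ContinualRegression.lastIterate (T.budgetedStep γ N) w₀ k τ)
            ∂(ContinualRegression.withoutReplacement M k)
          ≤ C * (Real.exp 1 * ‖w₀ - wStar‖ ^ 2 * T.radius ^ 2 /
            (2 * (1 - (1 - γ * T.radius ^ 2) ^ (2 * N))
              * (k : ℝ) ^ (1 - (1 - (1 - γ * T.radius ^ 2) ^ N)
                  * (1 - (1 - (1 - γ * T.radius ^ 2) ^ N) / 4)))))) := by
  refine ⟨fun d M k T w₀ wStar hM hk hT => ⟨fun lam hlam => ?_, fun γ N hγ hN => ?_⟩,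
    2, fun d M k T w₀ wStar hk hkM hT => ⟨fun lam hlam => ?_, fun γ N hγ hN => ?_⟩⟩
  · rcases eq_or_ne T.radius 0 with hR | hR
    -- The numerator R² on the right vanishes too, so the bound reads 0 ≤ 0.
    · simp [ContinualRegression.averageLoss_eq_zero_of_radius_eq_zero hT hR, hR]
    · obtain ⟨A, hA⟩ :=
        ContinualRegression.TaskCollection.exists_isSurrogate_regularizedStep hlam hT
      obtain ⟨h0, h1⟩ := ContinualRegression.regularized_coeff_mem T.radius hlam
      rw [ContinualRegression.regularized_bound_eq hlam hR]
      exact ContinualRegression.integral_withReplacement_le h0 h1 (by positivity) hM hk hT hA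
  · obtain ⟨A, hA⟩ :=
      ContinualRegression.TaskCollection.exists_isSurrogate_budgetedStep hγ hN hT
    obtain ⟨h0, h1⟩ := ContinualRegression.budgeted_coeff_mem hγ N
    rw [ContinualRegression.budgeted_bound_eq]
    exact ContinualRegression.integral_withReplacement_le h0 h1 (by positivity) hM hk hT hA
  · rcases eq_or_ne T.radius 0 with hR | hR
    · simp [ContinualRegression.averageLoss_eq_zero_of_radius_eq_zero hT hR, hR]
    · obtain ⟨A, hA⟩ :=
        ContinualRegression.TaskCollection.exists_isSurrogate_regularizedStep hlam hT
      obtain ⟨h0, h1⟩ := ContinualRegression.regularized_coeff_mem T.radius hlam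
      rw [ContinualRegression.regularized_bound_eq hlam hR]
      exact ContinualRegression.integral_withoutReplacement_le h0 h1 (by positivity) hk hkM hT hA
  · obtain ⟨A, hA⟩ :=
      ContinualRegression.TaskCollection.exists_isSurrogate_budgetedStep hγ hN hT
    obtain ⟨h0, h1⟩ := ContinualRegression.budgeted_coeff_mem hγ N
    rw [ContinualRegression.budgeted_bound_eq]
    exact ContinualRegression.integral_withoutReplacement_le h0 h1 (by positivity) hk hkM hT hA
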